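/- **Hill and Valley Lemma.** *Automata.* A parametric one-counter automaton (POCA) with a single parameter $p$ is a tuple $\mathcal C=(Q,\{p\},R,q_{init},F)$ with a non-empty finite set $Q$ of control states, a finite set $R\subseteq Q\times \mathsf{Op}\times Q$ of rules, $q_{init}\in Q$ and $F\subseteq Q$. The set $\mathsf{Op}$ consists of the updates $-1,0,+1,+p,-p$, the modulo tests $\mathsf{mod}\ c$ with $c\in\mathbb N$, $c\geq 1$, and the comparison tests $\bowtie c$ ($c\in\mathbb N$) and $\bowtie p$, where $\bowtie\in\{<,\le,=,\ge,>\}$. A configuration is a pair $q(z)\in Q\times\mathbb Z$. For $N\in\mathbb N$, an $N$-semirun $\pi$ of length $n\ge 0$ from $q_0(z_0)$ to $q_n(z_n)$ is a sequence of configurations $q_0(z_0),\dots,q_n(z_n)$ together with operations $\pi_0,\dots,\pi_{n-1}$ such that for every $i\in[0,n-1]$ we have $(q_i,\pi_i,q_{i+1})\in R$ and: $z_{i+1}=z_i+c$ if $\pi_i=c\in\{-1,0,1\}$; $z_{i+1}=z_i\pm N$ if $\pi_i=\pm p$; $z_{i+1}=z_i$ and $c\mid z_i$ if $\pi_i=\mathsf{mod}\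 c$; and only $z_{i+1}=z_i$ if $\pi_i$ is a comparison test. Let $\mathrm{Values}(\pi)=\{z_0,\dots,z_n\}$, with maximum $\max(\pi)$ and minimum $\min(\pi)$. *Constants.* Let $Z_{\mathcal C}\ge 1$ be the least common multiple of the nonzero constants $c$ that occur in operations $\mathsf{mod}\ c$ and $\bowtie c$ of the rules (with $Z_{\mathcal C}=1$ if there are none), let $\mathsf{LCM}(j)$ be the least common multiple of $1,\dots,j$, and put $$\Gamma_{\mathcal C}=\mathsf{LCM}(17|Q|)\,Z_{\mathcal C},\qquad \Upsilon_{\mathcal C}=17|Q|\cdot\mathsf{LCM}(17|Q|)\cdot(17|Q|Z_{\mathcal C}+2),\qquad M_{\mathcal C}=30(\Upsilon_{\mathcal C}+\Gamma_{\mathcal C}+1).$$ *Hills and valleys.* An $N$-semirun $\pi$ as above is a $B$-hill if $z_0,z_n<B$; $z_i\ge B$ for all $i\in[1,n-1]$; and for all $i\in[0,n-1]$, $\pi_i=-p$ implies $z_i>z_0+\Upsilon_{\mathcal C}$ and $\pi_i=+p$ implies $z_{i+1}>z_n+\Upsilon_{\mathcal C}$. It is a $B$-valley if $z_0,z_n>B$;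 $z_i\le B$ for all $i\in[1,n-1]$; and for all $i\in[0,n-1]$, $\pi_i=-p$ implies $z_{i+1}<z_n-\Upsilon_{\mathcal C}$ and $\pi_i=+p$ implies $z_i<z_0-\Upsilon_{\mathcal C}$. *Embeddings.* Let $\ell\in\mathbb Z$. A semirun $\sigma$ with configurations $s_0(y_0),\dots,s_k(y_k)$ is an $\ell$-embedding of a semirun $\pi$ with configurations $q_0(z_0),\dots,q_n(z_n)$ (the two parameter values may differ) if $s_0=q_0$, $s_k=q_n$, and there is a strictly increasing map $\psi:[0,k]\to[0,n]$ such that $\sigma_i=\pi_{\psi(i)}$ for all $i\in[0,k-1]$, and $\ell\bowtie y_i\iff \ell\bowtie z_{\psi(i)}$ for all $i\in[0,k]$ and all $\bowtie\in\{<,=,>\}$. It is min-rising if $\min(\sigma)\ge\min(\pi)$ and max-falling if $\max(\sigma)\le\max(\pi)$. *Statement.* Let $\mathcal C$ be a POCA with a single parameter $p$, let $N,B\in\mathbb N$ with $N>M_{\mathcal C}$, and let $\pi$ be an $N$-semirun from $q_0(z_0)$ to $q_n(z_n)$ with $\mathrm{Values}(\pi)\subseteq[0,4N]$. 1. If $\pi$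 is a $B$-hill, there is an $(N-\Gamma_{\mathcal C})$-semirun from $q_0(z_0)$ to $q_n(z_n)$ that is a min-rising and max-falling $(B-\Upsilon_{\mathcal C}-\Gamma_{\mathcal C}-1)$-embedding of $\pi$. 2. If $\pi$ is a $B$-valley, there is an $(N-\Gamma_{\mathcal C})$-semirun from $q_0(z_0)$ to $q_n(z_n)$ that is a min-rising and max-falling $(B+\Upsilon_{\mathcal C}+\Gamma_{\mathcal C}+1)$-embedding of $\pi$. -/

import Mathlib

/-- Comparison symbols `<, ≤, =, ≥, >` that occur in comparison tests. -/
inductive Cmp : Type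
  | lt | le | eq | ge | gt

/-- The operations over a set `P` of parameters. `SignType` is the set `{-1, 0, +1}`. -/
inductive Op (P : Type*) : Type _
  /-- add the constant `c ∈ {-1, 0, +1}` to the counter -/
  | addConst (c : SignType)
  /-- the update `+p` -/
  | addParam (p : P)
  /-- the update `-p` -/
  | subParam (p : P)
  /-- the modulo test `mod c` -/
  | modTest (c : ℕ)
  /-- the comparison test `⋈ c` against a constant -/
  | cmpConst (r : Cmp) (c : ℕ)
  /-- the comparison test `⋈ p` against a parameter -/
  | cmpParam (r : Cmp) (p : P)

/-- The constant of a modulo test or of a comparison test against a constant. -/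
def Op.consts {P : Type*} : Op P → Finset ℕ
  | .modTest c => {c}
  | .cmpConst _ c => {c}
  | _ => ∅

/-- A parametric one-counter automaton with control states `Q` and parameters `P`. -/
structure POCA (Q P : Type*) where
  /-- the finite set of rules -/
  rules : Finset (Q × Op P × Q)
  /-- the initial control state -/
  init : Q
  /-- the final control states -/
  final : Set Q

/-- The least common multiple of the nonzero elements of a finite set (`1` if there are none). -/
def lcmNonzero (S : Finset ℕ) : ℕ := (S.filter (fun m => m ≠ 0)).lcm id

/-- The least common multiple of `1, …, j`. -/
def lcmUpTo (j : ℕ) : ℕ := lcmNonzero (Finset.Icc 1 j)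

namespace POCA

variable {Q P : Type*}

/-- The constants that appear in the modulo tests and comparison tests of the rules. -/
def consts (C : POCA Q P) : Finset ℕ := C.rules.biUnion (fun r => r.2.1.consts)

/-- `Z_C = LCM(Consts(C))`. -/
def Z (C : POCA Q P) : ℕ := lcmNonzero C.consts

/-- `Γ_C = LCM(17|Q|) Z_C`. -/
def Gam [Fintype Q] (C : POCA Q P) : ℕ := lcmUpTo (17 * Fintype.card Q) * C.Z

/-- `Υ_C = 17|Q| LCM(17|Q|) (17|Q| Z_C + 2)`. -/
def Ups [Fintype Q] (C : POCA Q P) : ℕ :=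
  17 * Fintype.card Q * lcmUpTo (17 * Fintype.card Q) * (17 * Fintype.card Q * C.Z + 2)

/-- `M_C = 30 (Υ_C + Γ_C + 1)`. -/
def M [Fintype Q] (C : POCA Q P) : ℕ := 30 * (C.Ups + C.Gam + 1)

/-- The effect of an operation on the counter in a semitransition under the parameter valuation
`μ`: updates and modulo tests are respected, comparison tests only keep the counter value. -/
def SemiEffect (μ : P → ℕ) : Op P → ℤ → ℤ → Prop
  | .addConst c, z, z' => z' = z + (c : ℤ)
  | .addParam p, z, z' => z' = z + (μ p : ℤ)
  | .subParam p, z, z' => z' = z - (μ p : ℤ)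
  | .modTest c, z, z' => z = z' ∧ z' ≡ 0 [ZMOD (c : ℤ)]
  | .cmpConst _ _, z, z' => z = z'
  | .cmpParam _ _, z, z' => z = z'

/-- The semitransition `q(z) ⇝ q'(z')` with operation `op` under the valuation `μ`. -/
def SemiStep (C : POCA Q P) (μ : P → ℕ) (op : Op P) (c c' : Q × ℤ) : Prop :=
  (c.1, op, c'.1) ∈ C.rules ∧ SemiEffect μ op c.2 c'.2

/-- A `μ`-semirun `q₀(z₀) ⇝ q₁(z₁) ⇝ ⋯ ⇝ qₙ(zₙ)`, possibly of length `n = 0`. -/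
structure Semirun (C : POCA Q P) (μ : P → ℕ) where
  /-- the length `n` -/
  len : ℕ
  /-- the configurations `q₀(z₀), …, qₙ(zₙ)` -/
  conf : Fin (len + 1) → Q × ℤ
  /-- the operations of the `n` semitransitions -/
  op : Fin len → Op P
  /-- consecutive configurations are related by semitransitions -/
  step : ∀ i : Fin len, C.SemiStep μ (op i) (conf i.castSucc) (conf i.succ)

/-- For an automaton with a single parameter, an `N`-semirun is a semirun in which the parameter
has value `N`. -/
abbrev NSemirun [Unique P] (C : POCA Q P) (N : ℕ) := C.Semirun (fun _ => N)

namespace Semirun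

variable {C : POCA Q P} {μ ν : P → ℕ}

/-- The control state `qᵢ`. -/
def state (π : C.Semirun μ) (i : Fin (π.len + 1)) : Q := (π.conf i).1

/-- The counter value `zᵢ`. -/
def val (π : C.Semirun μ) (i : Fin (π.len + 1)) : ℤ := (π.conf i).2

/-- The source configuration `q₀(z₀)`. -/
def source (π : C.Semirun μ) : Q × ℤ := π.conf 0

/-- The target configuration `qₙ(zₙ)`. -/
def target (π : C.Semirun μ) : Q × ℤ := π.conf (Fin.last π.len)

/-- The set of counter values of the configurations. -/
def values (π : C.Semirun μ) : Set ℤ := Set.range π.val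

/-- The maximal counter value. -/
def max (π : C.Semirun μ) : ℤ := Finset.univ.sup' Finset.univ_nonempty π.val

/-- The minimal counter value. -/
def min (π : C.Semirun μ) : ℤ := Finset.univ.inf' Finset.univ_nonempty π.val

/-- `σ` is an `ℓ`-embedding of `π`. For `i < |σ|` strict monotonicity gives `ψ i < |π|`, so the
condition on operations says that the `i`-th operation of `σ` exists in `π` at position `ψ i`. -/
def IsEmbedding (ℓ : ℤ) (σ : C.Semirun ν) (π : C.Semirun μ) : Prop :=
  σ.state 0 = π.state 0 ∧
  σ.state (Fin.last σ.len) = π.state (Fin.last π.len) ∧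
  ∃ ψ : Fin (σ.len + 1) → Fin (π.len + 1), StrictMono ψ ∧
    (∀ i : Fin σ.len, ∃ h : (ψ i.castSucc : ℕ) < π.len, σ.op i = π.op ⟨ψ i.castSucc, h⟩) ∧
    (∀ i : Fin (σ.len + 1),
      (ℓ < σ.val i ↔ ℓ < π.val (ψ i)) ∧
      (ℓ = σ.val i ↔ ℓ = π.val (ψ i)) ∧
      (ℓ > σ.val i ↔ ℓ > π.val (ψ i)))

/-- `σ` is max-falling with respect to `π`. -/
def MaxFalling (σ : C.Semirun ν) (π : C.Semirun μ) : Prop := σ.max ≤ π.max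

/-- `σ` is min-rising with respect to `π`. -/
def MinRising (σ : C.Semirun ν) (π : C.Semirun μ) : Prop := π.min ≤ σ.min

/-- `π` is a `B`-hill. -/
def IsHill [Fintype Q] (B : ℤ) (π : C.Semirun μ) : Prop :=
  π.val 0 < B ∧ π.val (Fin.last π.len) < B ∧
  (∀ i : Fin (π.len + 1), 0 < (i : ℕ) → (i : ℕ) < π.len → π.val i ≥ B) ∧
  (∀ (i : Fin π.len) (p : P), π.op i = .subParam p →
    π.val i.castSucc > π.val 0 + C.Ups) ∧
  (∀ (i : Fin π.len) (p : P), π.op i = .addParam p →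
    π.val i.succ > π.val (Fin.last π.len) + C.Ups)

/-- `π` is a `B`-valley. -/
def IsValley [Fintype Q] (B : ℤ) (π : C.Semirun μ) : Prop :=
  π.val 0 > B ∧ π.val (Fin.last π.len) > B ∧
  (∀ i : Fin (π.len + 1), 0 < (i : ℕ) → (i : ℕ) < π.len → π.val i ≤ B) ∧
  (∀ (i : Fin π.len) (p : P), π.op i = .subParam p →
    π.val i.succ < π.val (Fin.last π.len) - C.Ups) ∧
  (∀ (i : Fin π.len) (p : P), π.op i = .addParam p →
    π.val i.castSucc < π.val 0 - C.Ups)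

end Semirun

end POCA

/-! Write the counter values as `z t = h t + N * b t`, where `b` is the balance of parameter updates
and `h` moves by at most one per step. Replacing `N` by `N - Γ` lowers position `t` by `b t * Γ`;
cutting cycles on which state and balance agree changes it by the cut effect. The target is kept
exactly when the cut effects total `b n * Γ`.

With `zs` the smaller end value, the `h`-axis is divided into bands of width `Υ`, repeated with
period `N`. Between the bands the invariant is that `k * Γ` has been cut in region `k`. The source
lies in region `0` and the target in region `b n`, because the ends of a hill differ by at most `N -
Υ` (`hill_ends_close`). Every crossing of a band must therefore cut exactly `Γ = L * Z`, upwards or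
downwards (`band_cut`). A band is wide enough for this by two pigeonhole arguments (`climb_cut`),
and everything cut is a multiple of `Z`, so modulo tests survive.

The window of width `4 * N` confines `b - k` to `[0, 4]`. Hence inner values never rise, fall by at
most `4 * Γ ≤ Υ + Γ`, and never drop below `zs`, which gives the embedding. Valleys are hills for
the negated counter. -/

/-! ### Cutting a prescribed height out of a climb -/

/-- Among `K * L` numbers between `1` and `K` some sum to `L`, if all of `1, …, K` divide `L`. -/
theorem exists_subset_sum_eq {K L : ℕ} (hK : 0 < K)
    (hdvd : ∀ d, 1 ≤ d → d ≤ K → d ∣ L) (D : ℕ → ℕ)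
    (hD : ∀ r < K * L, 1 ≤ D r ∧ D r ≤ K) :
    ∃ S ⊆ Finset.range (K * L), ∑ r ∈ S, D r = L := by
  -- Some value `d` is taken at least `L` times; `L / d` of these occurrences suffice.
  obtain ⟨d, hd, hcard⟩ := Finset.exists_le_card_fiber_of_mul_le_card_of_maps_to
    (s := Finset.range (K * L)) (t := Finset.Icc 1 K) (f := D) (n := L)
    (fun r hr => by simpa using hD r (by simpa using hr))
    ⟨1, by simp; omega⟩ (by simp)
  rw [Finset.mem_Icc] at hd
  have hdL := hdvd d hd.1 hd.2
  obtain ⟨S, hS, hSc⟩ := Finset.exists_subset_card_eq ((Nat.div_le_self L d).trans hcard)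
  refine ⟨S, hS.trans (Finset.filter_subset _ _), ?_⟩
  rw [Finset.sum_congr rfl (fun r hr => (Finset.mem_filter.1 (hS hr)).2), Finset.sum_const, hSc,
    smul_eq_mul, Nat.div_mul_cancel hdL]

/-- A walk with steps of height at most one hits all levels in increasing order. -/
theorem exists_hitting_times (g : ℕ → ℤ) {i j U : ℕ} (hij : i ≤ j)
    (hstep : ∀ t, i ≤ t → t < j → g (t + 1) ≤ g t + 1) (hU : g i + U ≤ g j) :
    ∃ T : ℕ → ℕ, ∀ m ≤ U, i ≤ T m ∧ T m ≤ j ∧ g (T m) = g i + m ∧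
      ∀ m' < m, T m' < T m := by
  classical
  -- First hitting times: their minimality is what makes them increase with the level.
  have hex : ∀ m : ℕ, ∃ t, m ≤ U → i ≤ t ∧ t ≤ j ∧ g (t) = g i + m ∧
      ∀ s, i ≤ s → s < t → g s < g i + m := by
    intro m
    by_cases hm : m ≤ U
    swap
    · exact ⟨0, fun h => absurd h hm⟩
    have he : ∃ t, i ≤ t ∧ g i + m ≤ g t := ⟨j, hij, by omega⟩
    have hs := Nat.find_spec he
    have hmin : ∀ s, i ≤ s → s < Nat.find he → g s < g i + m := fun s h1 h2 => by
      have := Nat.find_min he h2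
      push Not at this
      exact this h1
    have hle : Nat.find he ≤ j := Nat.find_min' he ⟨hij, by omega⟩
    refine ⟨Nat.find he, fun _ => ⟨hs.1, hle, ?_, hmin⟩⟩
    generalize Nat.find he = t at *
    rcases Nat.eq_or_lt_of_le hs.1 with h | h
    · subst h; omega
    · obtain ⟨s, rfl⟩ : ∃ s, t = s + 1 := ⟨t - 1, by omega⟩
      have h1 := hmin s (by omega) (by omega)
      have h2 := hstep s (by omega) (by omega)
      omega
  choose T hT using hex
  refine ⟨T, fun m hm => ⟨(hT m hm).1, (hT m hm).2.1, (hT m hm).2.2.1, fun m' hm' => ?_⟩⟩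
  have h1 := hT m hm
  have h2 := hT m' (by omega)
  by_contra hcon
  rcases Nat.eq_or_lt_of_le (not_lt.1 hcon) with h | h
  · rw [← h] at h2; omega
  · have := h2.2.2.2 _ h1.1 h
    omega

/-- Along a walk that climbs by at least `K * L * (K * Z + 2)`, cycles on a colour whose heights
add up to exactly `L * Z` can be cut out. In `P t m`, the number `m` counts the multiples of `Z`
that were cut before time `t`. -/
theorem climb_cut {α : Type*} [Fintype α] {L Z : ℕ} (hL : 0 < L) (hZ : 0 < Z)
    (hK : 0 < Fintype.card α)
    (hdvd : ∀ d, 1 ≤ d → d ≤ Fintype.card α → d ∣ L)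
    (g : ℕ → ℤ) (col : ℕ → α) (P : ℕ → ℕ → Prop) {i j : ℕ} (hij : i ≤ j)
    (hstep : ∀ t, i ≤ t → t < j → g (t + 1) ≤ g t + 1)
    (hU : g i + (Fintype.card α * L * (Fintype.card α * Z + 2) : ℕ) ≤ g j)
    (step : ∀ t m, i ≤ t → t < j → m ≤ L → (t = i → m = 0) → P t m → P (t + 1) m)
    (cut : ∀ a b m d, i < a → a < b → b < j → m + d ≤ L → col a = col b → g b = g a + d * Z →
      P a m → P b (m + d))
    (hP : P i 0) : P j L := by
  classical
  set K := Fintype.card α with hKdef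
  obtain ⟨T, hT⟩ := exists_hitting_times g hij hstep hU
  set U := K * L * (K * Z + 2) with hUdef
  have hKL : 0 < K * L := Nat.mul_pos hK hL
  -- Levels `1, …, K * L * w` split into `K * L` blocks of `w` levels. Level `0` and the remaining
  -- `K * L` levels keep every cut strictly inside `(i, j)`.
  set w := K * Z + 1 with hw
  have hUw : U = K * L * w + K * L := by rw [hUdef, hw]; ring
  have copy : ∀ m ≤ L, ∀ s t, i ≤ s → (s = i → m = 0) → s ≤ t → t ≤ j → P s m → P t m := by
    intro m hm s t his hsi hst
    induction t, hst using Nat.le_induction with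
    | base => exact fun _ h => h
    | succ t hst ih => exact fun htj h => step t m (by omega) (by omega) hm (by omega) (ih (by omega) h)
  have hlev : ∀ r < K * L, r * w + w ≤ K * L * w := fun r hr => by
    calc r * w + w = (r + 1) * w := by ring
      _ ≤ K * L * w := Nat.mul_le_mul_right _ hr
  -- A block contains `K + 1` levels at spacing `Z`, so two of them are hit in the same colour; they
  -- differ by `d * Z` with `1 ≤ d ≤ K`.
  have hblock : ∀ r, ∃ u v d : ℕ, r < K * L →
      r * w + 1 ≤ u ∧ u < v ∧ v ≤ r * w + w ∧ v = u + d * Z ∧ 1 ≤ d ∧ d ≤ K ∧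
      col (T u) = col (T v) := by
    intro r
    by_cases hr : r < K * L
    swap
    · exact ⟨0, 0, 0, fun h => absurd h hr⟩
    obtain ⟨x, y, hxy, hc⟩ := Fintype.exists_ne_map_eq_of_card_lt
      (fun x : Fin (K + 1) => col (T (r * w + 1 + x * Z))) (by simp [← hKdef])
    wlog hlt : x < y generalizing x y
    · exact this y x hxy.symm hc.symm (lt_of_le_of_ne (not_lt.1 hlt) hxy.symm)
    have hlt' : (x : ℕ) < y := hlt
    obtain ⟨d, hd⟩ : ∃ d, (y : ℕ) = x + d := ⟨y - x, by omega⟩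
    have hyK : (y : ℕ) ≤ K := by omega
    have h1 : (y : ℕ) * Z = x * Z + d * Z := by rw [hd]; ring
    have h2 : (y : ℕ) * Z ≤ K * Z := Nat.mul_le_mul_right _ hyK
    have h3 : 0 < d * Z := Nat.mul_pos (by omega) hZ
    exact ⟨r * w + 1 + x * Z, r * w + 1 + y * Z, d, fun _ =>
      ⟨by omega, by omega, by omega, by omega, by omega, by omega, hc⟩⟩
  choose u v d hblock using hblock
  obtain ⟨S, hS, hsum⟩ := exists_subset_sum_eq hK hdvd d
    (fun r hr => ⟨(hblock r hr).2.2.2.2.1, (hblock r hr).2.2.2.2.2.1⟩)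
  have hpart : ∀ r, ∑ s ∈ S with s < r, d s ≤ L := fun r => by
    rw [← hsum]
    exact Finset.sum_le_sum_of_subset (Finset.filter_subset _ _)
  -- Walk block by block, cutting the cycle of block `r` exactly when `r ∈ S`.
  have hmain : ∀ r ≤ K * L, P (T (r * w + 1)) (∑ s ∈ S with s < r, d s) := by
    intro r
    induction r with
    | zero =>
      intro _
      have h1 := hT 1 (by omega)
      simpa using copy 0 (by omega) i (T 1) le_rfl (fun _ => rfl) h1.1 h1.2.1 hP
    | succ r ih =>
      intro hr
      have hr' : r < K * L := hr
      have ihr := ih hr'.le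
      obtain ⟨h1, h2, h3, h4, -, -, h5⟩ := hblock r hr'
      have hl := hlev r hr'
      have e1 : (r + 1) * w = r * w + w := by ring
      have t0 := hT (r * w + 1) (by omega)
      have ti := (hT 0 (by omega)).1
      have ti0 := t0.2.2.2 0 (by omega)
      have tu := hT (u r) (by omega)
      have tv := hT (v r) (by omega)
      have tw := hT ((r + 1) * w + 1) (by omega)
      have tU := hT U le_rfl
      have tuv := tv.2.2.2 _ h2
      have tvU := tU.2.2.2 (v r) (by omega)
      have t0u : T (r * w + 1) ≤ T (u r) := by
        rcases Nat.eq_or_lt_of_le h1 with h | h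
        · rw [h]
        · exact (tu.2.2.2 _ h).le
      have tvw := (tw.2.2.2 (v r) (by omega)).le
      by_cases hrS : r ∈ S
      · have hfs : (S.filter (fun s => s < r + 1)) = insert r (S.filter (fun s => s < r)) := by
          ext s
          simp only [Finset.mem_filter, Finset.mem_insert]
          constructor
          · rintro ⟨a, b⟩
            by_cases h : s = r
            · exact Or.inl h
            · exact Or.inr ⟨a, by omega⟩
          · rintro (rfl | ⟨a, b⟩)
            · exact ⟨hrS, by omega⟩
            · exact ⟨a, by omega⟩
        have hs2 : ∑ s ∈ S with s < r + 1, d s = ∑ s ∈ S with s < r, d s + d r := by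
          rw [hfs, Finset.sum_insert (by simp), add_comm]
        have hle := hpart (r + 1)
        rw [hs2] at hle ⊢
        refine copy _ hle (T (v r)) _ (by omega) (by omega) tvw (by omega) ?_
        refine cut (T (u r)) (T (v r)) _ _ (by omega) tuv (by omega) hle h5 ?_
          (copy _ (by omega) _ _ t0.1 (by omega) t0u tu.2.1 ihr)
        rw [tu.2.2.1, tv.2.2.1, h4]
        push_cast
        ring
      · have hfs : (S.filter (fun s => s < r + 1)) = S.filter (fun s => s < r) := by
          refine Finset.filter_congr fun s hs => ?_
          have : s ≠ r := fun h => hrS (h ▸ hs)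
          omega
        rw [hfs]
        exact copy _ (hpart r) _ _ t0.1 (by omega) (by omega) tw.2.1 ihr
  have hend := hmain (K * L) le_rfl
  have hall : (S.filter (fun s => s < K * L)) = S :=
    Finset.filter_true_of_mem fun s hs => Finset.mem_range.1 (hS hs)
  rw [hall, hsum] at hend
  have ti := (hT 0 (by omega)).1
  have tw := hT (K * L * w + 1) (by omega)
  have ti0 := tw.2.2.2 0 (by omega)
  exact copy L le_rfl _ _ tw.1 (by omega) tw.2.1 le_rfl hend

/-! ### Bands and the compensation of the parameter decrease -/

/-- The window forces `0 ≤ b - k ≤ 4`. If `b = k` nothing is shifted; otherwise the value exceeds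
`zs` by at least `(b - k) * N`, far more than the drop `(b - k) * G`. -/
theorem shift_bounds_of_between_bands {N G U zs h b k : ℤ} (hG : 0 < G) (hU : 0 < U)
    (hN : 30 * (U + G + 1) < N) (hz : zs ≤ h + N * b) (hz' : h + N * b ≤ zs + 4 * N)
    (h1 : zs - k * N ≤ h) (h2 : h ≤ zs + N - U - k * N) :
    zs ≤ h + N * b + k * G - b * G ∧ k * G ≤ b * G ∧ (b - 4) * G ≤ k * G := by
  obtain ⟨e, rfl⟩ : ∃ e, b = k + e := ⟨b - k, by ring⟩
  have he : 0 ≤ e := by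
    by_contra hc
    nlinarith [mul_le_mul_of_nonneg_left (show e ≤ -1 by omega) (show 0 ≤ N by omega)]
  have he' : e ≤ 4 := by
    by_contra hc
    nlinarith [mul_le_mul_of_nonneg_left (show 5 ≤ e by omega) (show 0 ≤ N by omega)]
  refine ⟨?_, ?_, ?_⟩ <;> interval_cases e <;> nlinarith

/-- Inside a band `b = k` is impossible, since the value would be below `zs`. So `b ≥ k + 1`, and
even a fully compensated `c = (k + 1) * G` does not raise the value. -/
theorem shift_bounds_of_mem_band {N G U zs h b k c : ℤ} (hG : 0 < G) (hU : 0 < U)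
    (hN : 30 * (U + G + 1) < N) (hz : zs ≤ h + N * b) (hz' : h + N * b ≤ zs + 4 * N)
    (h1 : zs - U - k * N < h) (h2 : h < zs - k * N)
    (hc : k * G ≤ c) (hc' : c ≤ (k + 1) * G) :
    (zs ≤ h + N * b + c - b * G ∧ c ≤ b * G ∧ (b - 4) * G ≤ c) ∧ 1 ≤ b - k ∧ b - k ≤ 4 := by
  obtain ⟨e, rfl⟩ : ∃ e, b = k + e := ⟨b - k, by ring⟩
  have he : 1 ≤ e := by
    by_contra hc
    nlinarith [mul_le_mul_of_nonneg_left (show e ≤ 0 by omega) (show 0 ≤ N by omega)]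
  have he' : e ≤ 4 := by
    by_contra hc
    nlinarith [mul_le_mul_of_nonneg_left (show 5 ≤ e by omega) (show 0 ≤ N by omega)]
  refine ⟨⟨?_, ?_, ?_⟩, by omega, by omega⟩ <;> interval_cases e <;> nlinarith

theorem between_bands_or_mem_band {N : ℤ} (hN : 0 < N) (U zs h : ℤ) :
    (∃ k, zs - k * N ≤ h ∧ h ≤ zs + N - U - k * N) ∨
    (∃ k, zs - U - k * N < h ∧ h < zs - k * N) := by
  have h1 := Int.emod_nonneg (h - zs) hN.ne'
  have h2 := Int.emod_lt_of_pos (h - zs) hN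
  have h3 := Int.mul_ediv_add_emod (h - zs) N
  set m := (h - zs) / N
  set r := (h - zs) % N
  by_cases hr : r ≤ N - U
  · exact Or.inl ⟨-m, by linarith, by linarith⟩
  · exact Or.inr ⟨-m - 1, by linarith, by linarith⟩

theorem eq_of_lt_of_lt_mul {N j k : ℤ} (hN : 0 < N) (h1 : k * N < j * N + N)
    (h2 : j * N < k * N + N) : j = k := by
  have h3 : k < j + 1 := lt_of_mul_lt_mul_right (by linarith) hN.le
  have h4 : j < k + 1 := lt_of_mul_lt_mul_right (by linarith) hN.le
  omega

/-- A run with counter values `h t + N * b t` in a window of width `4 * N`, where `h` is a walk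
with steps of height at most one, `b` is the balance of the parameter updates, and both ends are
close to the bottom of the window. Cutting cycles wherever `h` crosses one of the bands
`(zs - U - k * N, zs - k * N)` compensates a decrease of the parameter by `G = L * Z`. In `P t c`,
the number `c` is the sum of the effects cut before time `t`. -/
theorem band_cut {Q : Type*} [Fintype Q] [Nonempty Q] {n : ℕ} (q : ℕ → Q) (h b : ℕ → ℤ)
    (N L Z : ℕ) (zs G U : ℤ) (hL : 0 < L) (hZ : 0 < Z)
    (hdvd : ∀ d, 1 ≤ d → d ≤ 17 * Fintype.card Q → d ∣ L)
    (hG : G = L * Z)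
    (hU : U = (17 * Fintype.card Q * L * (17 * Fintype.card Q * Z + 2) : ℕ))
    (hN : 30 * (U + G + 1) < N)
    (hstep : ∀ t < n, h t ≤ h (t + 1) + 1 ∧ h (t + 1) ≤ h t + 1)
    (hz : ∀ t ≤ n, zs ≤ h t + N * b t ∧ h t + N * b t ≤ zs + 4 * N)
    (hb0 : b 0 = 0) (hz0 : h 0 ≤ zs + N - U) (hzn : h n + N * b n ≤ zs + N - U)
    (P : ℕ → ℤ → Prop) (hP : P 0 0)
    (step : ∀ t < n, ∀ c : ℤ, (Z : ℤ) ∣ c → (0 < t → zs ≤ h t + N * b t + c - b t * G ∧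
      c ≤ b t * G ∧ (b t - 4) * G ≤ c) → P t c → P (t + 1) c)
    (cut : ∀ s t, 0 < s → s < t → t < n → q s = q t → b s = b t → ∀ c : ℤ, P s c →
      P t (c + h s - h t)) :
    P n (b n * G) := by
  have hQ : 0 < Fintype.card Q := Fintype.card_pos
  have hGpos : 0 < G := by rw [hG]; exact_mod_cast Nat.mul_pos hL hZ
  have hUpos : 1 < U := by
    rw [hU]
    have : 1 ≤ 17 * Fintype.card Q * L := Nat.mul_pos (by omega) hL
    exact_mod_cast (show 1 < 1 * (0 + 2) by norm_num).trans_le (Nat.mul_le_mul this (by omega))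
  have hZG : (Z : ℤ) ∣ G := ⟨L, by rw [hG]; ring⟩
  have hNpos : (0 : ℤ) < N := by linarith
  have hcard : Fintype.card (Q × ZMod 17) = 17 * Fintype.card Q := by
    rw [Fintype.card_prod, ZMod.card, mul_comm]
  have h0 : zs ≤ h 0 := by have := (hz 0 (by omega)).1; rw [hb0] at this; linarith
  have key : ∀ t ≤ n, ∀ k : ℤ, zs - k * N ≤ h t → h t ≤ zs + N - U - k * N → P t (k * G) := by
    intro t
    induction t using Nat.strong_induction_on with
    | _ t ih =>
    intro htn k hk1 hk2
    rcases t with _ | t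
    · have : k = 0 := eq_of_lt_of_lt_mul hNpos (by linarith) (by linarith)
      subst this
      simpa using hP
    have hst := hstep t (by omega)
    rcases between_bands_or_mem_band hNpos U zs (h t) with ⟨k', h1, h2⟩ | ⟨k', h1, h2⟩
    · have : k' = k := eq_of_lt_of_lt_mul hNpos (by linarith) (by linarith)
      subst this
      have hzt := hz t (by omega)
      exact step t (by omega) _ (hZG.mul_left _)
        (fun _ => shift_bounds_of_between_bands hGpos (by linarith) hN hzt.1 hzt.2 h1 h2)
        (ih t (by omega) (by omega) k' h1 h2)
    -- The last position before the current visit to the band. It exists because position `0` lies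
    -- in no band.
    have hex : ∃ i < t, ¬ (zs - U - k' * N < h i ∧ h i < zs - k' * N) ∧
        ∀ s, i < s → s ≤ t → zs - U - k' * N < h s ∧ h s < zs - k' * N := by
      by_contra hcon
      have hall : ∀ d ≤ t, zs - U - k' * N < h (t - d) ∧ h (t - d) < zs - k' * N := by
        intro d
        induction d using Nat.strong_induction_on with
        | _ d ihd =>
        intro hd
        by_contra hnb
        refine hcon ⟨t - d, ?_, hnb, fun s hs1 hs2 => ?_⟩
        · rcases d with _ | d
          · exact absurd ⟨h1, h2⟩ hnb
          · omega
        · have := ihd (t - s) (by omega) (by omega)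
          rwa [Nat.sub_sub_self hs2] at this
      have hb := hall t le_rfl
      rw [Nat.sub_self] at hb
      have : k' < 0 := by
        by_contra hc
        nlinarith [mul_nonneg (not_lt.1 hc) hNpos.le]
      nlinarith [mul_le_mul_of_nonneg_right (show k' ≤ -1 by omega) hNpos.le]
    obtain ⟨i, hit, hni, hin⟩ := hex
    have hi1 := hin (i + 1) (by omega) (by omega)
    have hsi := hstep i (by omega)
    have hzi := hz i (by omega)
    have hband : ∀ s, i < s → s ≤ t → ∀ c, k' * G ≤ c → c ≤ (k' + 1) * G → _ :=
      fun s h3 h4 c hc hc' => shift_bounds_of_mem_band hGpos (by linarith) hN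
        (hz s (by omega)).1 (hz s (by omega)).2 (hin s h3 h4).1 (hin s h3 h4).2 hc hc'
    have copy : ∀ c, (Z : ℤ) ∣ c → k' * G ≤ c → c ≤ (k' + 1) * G → P (i + 1) c → P (t + 1) c := by
      intro c hZc hc hc' hPc
      have : ∀ s, i + 1 ≤ s → s ≤ t + 1 → P s c := by
        intro s hs
        induction s, hs using Nat.le_induction with
        | base => exact fun _ => hPc
        | succ s hs ihs =>
          exact fun hst => step s (by omega) c hZc
            (fun _ => (hband s (by omega) (by omega) c hc hc').1) (ihs (by omega))
      exact this (t + 1) (by omega) le_rfl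
    -- Within one band the balance takes at most four values, so its residue mod `17` determines it.
    have hcol : ∀ s s', i < s → s < s' → s' < t + 1 →
        (q s, (b s : ZMod 17)) = (q s', (b s' : ZMod 17)) → q s = q s' ∧ b s = b s' := by
      intro s s' h3 h4 h5 he
      rw [Prod.mk.injEq] at he
      refine ⟨he.1, ?_⟩
      have hd := (ZMod.intCast_eq_intCast_iff_dvd_sub _ _ 17).1 he.2
      have hs := (hband s h3 (by omega) _ le_rfl (by linarith)).2
      have hs' := (hband s' (by omega) (by omega) _ le_rfl (by linarith)).2
      omega
    -- Steps of height at most one make the walk enter and leave the band exactly at its edges.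
    have hiend : h i = zs - k' * N ∨ h i = zs - U - k' * N := by omega
    have htend : (h (t + 1) = zs - k' * N ∧ k = k') ∨
        (h (t + 1) = zs - U - k' * N ∧ k = k' + 1) := by
      by_cases hlt : h (t + 1) < zs - k' * N
      · right
        have : k = k' + 1 := eq_of_lt_of_lt_mul hNpos (by linarith) (by linarith)
        subst this
        exact ⟨by linarith, rfl⟩
      · left
        have : k = k' := eq_of_lt_of_lt_mul hNpos (by linarith) (by linarith)
        subst this
        exact ⟨by linarith, rfl⟩
    have hPi : ∀ j : ℤ, zs - j * N ≤ h i → h i ≤ zs + N - U - j * N →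
        P i (j * G) ∧ P (i + 1) (j * G) := by
      intro j hj1 hj2
      have hPj := ih i (by omega) (by omega) j hj1 hj2
      exact ⟨hPj, step i (by omega) _ (hZG.mul_left _)
        (fun _ => shift_bounds_of_between_bands hGpos (by linarith) hN hzi.1 hzi.2 hj1 hj2) hPj⟩
    have hmul : ∀ m : ℕ, m ≤ L → 0 ≤ (m : ℤ) * Z ∧ (m : ℤ) * Z ≤ G := fun m hm => by
      rw [hG]
      exact ⟨by positivity, by exact_mod_cast Nat.mul_le_mul_right _ hm⟩
    -- Returning to the edge of entry requires no cut. A descent through the band adds `G` to the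
    -- cut effect, obtained by applying `climb_cut` to `-h`; an ascent subtracts `G`.
    rcases hiend with hi | hi <;> rcases htend with ⟨ht, rfl⟩ | ⟨ht, rfl⟩
    · exact copy _ (hZG.mul_left _) le_rfl (by linarith) (hPi k (by linarith) (by linarith)).2
    · have := climb_cut (α := Q × ZMod 17) hL hZ (by rw [hcard]; omega) (by rwa [hcard])
        (fun s => - h s) (fun s => (q s, (b s : ZMod 17)))
        (fun s m => P s (k' * G + m * Z)) (i := i) (j := t + 1) (by omega)
        (fun s h3 h4 => by have := hstep s (by omega); linarith)
        (by rw [hcard, ← hU]; linarith)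
        (fun s m h3 h4 hm hm0 hPs => ?_) (fun s s' m d h3 h4 h5 hm hc hd hPs => ?_) ?_
      · convert this using 1
        rw [hG]; ring
      · rcases Nat.eq_or_lt_of_le h3 with rfl | h3
        · simpa [hm0 rfl] using (hPi k' (by linarith) (by linarith)).2
        · have := hmul m hm
          exact step s (by omega) _ (dvd_add (hZG.mul_left _) (dvd_mul_left _ _))
            (fun _ => (hband s h3 (by omega) _ (by linarith) (by linarith)).1) hPs
      · obtain ⟨hq, hb⟩ := hcol s s' h3 h4 h5 hc
        convert cut s s' (by omega) h4 (by omega) hq hb _ hPs using 1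
        push_cast
        linarith
      · simpa using (hPi k' (by linarith) (by linarith)).1
    · have := climb_cut (α := Q × ZMod 17) hL hZ (by rw [hcard]; omega) (by rwa [hcard])
        h (fun s => (q s, (b s : ZMod 17)))
        (fun s m => P s ((k + 1) * G - m * Z)) (i := i) (j := t + 1) (by omega)
        (fun s h3 h4 => by have := hstep s (by omega); linarith)
        (by rw [hcard, ← hU]; linarith)
        (fun s m h3 h4 hm hm0 hPs => ?_) (fun s s' m d h3 h4 h5 hm hc hd hPs => ?_) ?_
      · convert this using 1
        rw [hG]; ring
      · rcases Nat.eq_or_lt_of_le h3 with rfl | h3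
        · simpa [hm0 rfl] using (hPi (k + 1) (by linarith) (by linarith)).2
        · have := hmul m hm
          exact step s (by omega) _ (dvd_sub (hZG.mul_left _) (dvd_mul_left _ _))
            (fun _ => (hband s h3 (by omega) _ (by linarith) (by linarith)).1) hPs
      · obtain ⟨hq, hb⟩ := hcol s s' h3 h4 h5 hc
        convert cut s s' (by omega) h4 (by omega) hq hb _ hPs using 1
        push_cast
        linarith
      · simpa using (hPi (k + 1) (by linarith) (by linarith)).1
    · exact copy _ (hZG.mul_left _) (by linarith) le_rfl
        (hPi (k' + 1) (by linarith) (by linarith)).2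
  -- The final value lies in `[zs, zs + N - U]`, which places `h n` in region `b n`.
  have hzn' := (hz n le_rfl).1
  exact key n le_rfl (b n) (by linarith) (by linarith)

/-! ### Least common multiples and parameter signs -/

theorem dvd_lcmNonzero {S : Finset ℕ} {d : ℕ} (hd : d ∈ S) (h0 : d ≠ 0) : d ∣ lcmNonzero S :=
  Finset.dvd_lcm (f := id) (Finset.mem_filter.2 ⟨hd, h0⟩)

theorem lcmNonzero_pos (S : Finset ℕ) : 0 < lcmNonzero S := by
  refine Nat.pos_of_ne_zero fun h => ?_
  obtain ⟨d, hd, h0⟩ := Finset.lcm_eq_zero_iff.1 h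
  exact (Finset.mem_filter.1 hd).2 h0

/-- The sign with which the parameter enters an operation. -/
def Op.paramSign {P : Type*} : Op P → ℤ
  | .addParam _ => 1
  | .subParam _ => -1
  | _ => 0

theorem Op.addParam_of_paramSign {P : Type*} {o : Op P} (h : o.paramSign = 1) :
    ∃ p, o = .addParam p := by
  cases o <;> simp_all [Op.paramSign]

theorem Op.subParam_of_paramSign {P : Type*} {o : Op P} (h : o.paramSign = -1) :
    ∃ p, o = .subParam p := by
  cases o <;> simp_all [Op.paramSign]

theorem Op.paramSign_cases {P : Type*} (o : Op P) :
    o.paramSign = 1 ∨ o.paramSign = -1 ∨ o.paramSign = 0 := by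
  cases o <;> simp [Op.paramSign]

/-- The ends of a hill are less than `N - U` apart. -/
theorem hill_ends_close {n : ℕ} {z s : ℕ → ℤ} {N U B : ℤ} (hU : 0 ≤ U) (hN : U < N)
    (hs : ∀ t, s t = 1 ∨ s t = -1 ∨ s t = 0)
    (hstep : ∀ t < n, z t + N * s t ≤ z (t + 1) + 1 ∧ z (t + 1) ≤ z t + N * s t + 1)
    (h0 : z 0 < B) (hn : z n < B) (hin : ∀ t, 0 < t → t < n → B ≤ z t)
    (hsub : ∀ t < n, s t = -1 → z 0 + U < z t)
    (hadd : ∀ t < n, s t = 1 → z n + U < z (t + 1)) :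
    z 0 ≤ z n + N - U ∧ z n ≤ z 0 + N - U := by
  rcases n with _ | n
  · constructor <;> linarith
  have f1 := hstep 0 (by omega)
  have f2 := hsub 0 (by omega)
  have f3 := hadd 0 (by omega)
  have l1 := hstep n (by omega)
  have l2 := hsub n (by omega)
  have l3 := hadd n (by omega)
  rcases n with _ | n
  · simp only [zero_add] at f1 f3 ⊢
    rcases hs 0 with h | h | h
    · linarith [f3 h]
    · linarith [f2 h]
    · rw [h, mul_zero] at f1
      constructor <;> linarith
  have i1 := hin 1 (by omega) (by omega)
  have i2 := hin (n + 1) (by omega) (by omega)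
  simp only [zero_add] at f1 f3
  -- A last step `-p` starts above `z 0 + U`, and a first step `+p` ends above `z n + U`; each gives
  -- one inequality. If instead such an extremal step has sign `0`, its outer end is at least `B -
  -- 1`, so the other end is no larger.
  constructor
  · rcases hs (n + 1) with h | h | h
    · rw [h] at l1; linarith
    · rw [h] at l1; linarith [l2 h]
    · rw [h] at l1; linarith
  · rcases hs 0 with h | h | h
    · rw [h] at f1; linarith [f3 h]
    · rw [h] at f1; linarith
    · rw [h] at f1; linarith

namespace POCA

variable {Q P : Type*}

theorem SemiEffect.walk {N : ℕ} {o : Op P} {z z' : ℤ} (h : SemiEffect (fun _ => N) o z z') :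
    z + N * o.paramSign ≤ z' + 1 ∧ z' ≤ z + N * o.paramSign + 1 := by
  cases o with
  | addConst c =>
    simp only [SemiEffect] at h
    subst h
    rcases c with _ | _ | _ <;> simp only [Op.paramSign] <;> simp; omega
  | _ =>
    simp only [SemiEffect] at h
    simp only [Op.paramSign]
    omega

/-- Semitransitions can be shifted when the parameter is decreased. -/
theorem SemiEffect.shift {N G : ℕ} (hG : G ≤ N) {o : Op P} {z z' x : ℤ}
    (h : SemiEffect (fun _ => N) o z z') (hx : ∀ c, o = .modTest c → (c : ℤ) ∣ x) :
    SemiEffect (fun _ => N - G) o (z + x) (z' + x - o.paramSign * G) := by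
  cases o with
  | modTest c =>
    obtain ⟨rfl, h2⟩ := h
    refine ⟨by simp [Op.paramSign], ?_⟩
    simpa [Op.paramSign] using
      Int.modEq_zero_iff_dvd.2 (dvd_add (Int.modEq_zero_iff_dvd.1 h2) (hx c rfl))
  | addConst c => simp only [SemiEffect, Op.paramSign] at h ⊢; subst h; ring
  | addParam p => simp only [SemiEffect, Op.paramSign] at h ⊢; subst h; push_cast [hG]; ring
  | subParam p => simp only [SemiEffect, Op.paramSign] at h ⊢; subst h; push_cast [hG]; ring
  | cmpConst r c => simp only [SemiEffect, Op.paramSign] at h ⊢; subst h; ring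
  | cmpParam r p => simp only [SemiEffect, Op.paramSign] at h ⊢; subst h; ring

/-! ### Semiruns obtained by cutting cycles -/

/-- `CutReach ν n q op z₀ Good t y`: cutting cycles from the path with states `q` and operations
`op` gives, from the counter value `z₀`, a run with parameter valuation `ν` to the position `t`
with the counter value `y`, where `Good` holds at every position that the run leaves by a
semitransition. -/
inductive CutReach (ν : P → ℕ) (n : ℕ) (q : ℕ → Q) (op : ℕ → Op P) (z₀ : ℤ)
    (Good : ℕ → ℤ → Prop) : ℕ → ℤ → Prop
  | init : CutReach ν n q op z₀ Good 0 z₀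
  | step {t : ℕ} {y y' : ℤ} : t < n → CutReach ν n q op z₀ Good t y → Good t y →
      SemiEffect ν (op t) y y' → CutReach ν n q op z₀ Good (t + 1) y'
  | cut {s t : ℕ} {y : ℤ} : s < t → q s = q t → CutReach ν n q op z₀ Good s y →
      CutReach ν n q op z₀ Good t y

/-- A cut always ends at a positive position, so the source value cannot change. -/
theorem CutReach.eq_of_zero {ν : P → ℕ} {n : ℕ} {q : ℕ → Q} {op : ℕ → Op P} {z₀ y : ℤ}
    {Good : ℕ → ℤ → Prop} (h : CutReach ν n q op z₀ Good 0 y) : y = z₀ := by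
  cases h with
  | init => rfl
  | cut h => omega

theorem CutReach.exists_run {C : POCA Q P} {ν : P → ℕ} {n : ℕ} {q : ℕ → Q} {op : ℕ → Op P}
    {z₀ : ℤ} {Good : ℕ → ℤ → Prop} (hrules : ∀ t < n, (q t, op t, q (t + 1)) ∈ C.rules)
    {t : ℕ} {y : ℤ} (h : CutReach ν n q op z₀ Good t y) :
    ∃ (k : ℕ) (conf : ℕ → Q × ℤ) (ψ : ℕ → ℕ), conf 0 = (q 0, z₀) ∧ conf k = (q t, y) ∧ ψ k = t ∧
      ∀ i < k, C.SemiStep ν (op (ψ i)) (conf i) (conf (i + 1)) ∧ ψ i < n ∧ ψ i < ψ (i + 1) ∧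
        Good (ψ i) (conf i).2 := by
  induction h with
  | init => exact ⟨0, fun _ => (q 0, z₀), fun _ => 0, rfl, rfl, rfl, by simp⟩
  | @step t y y' ht _ hg he ih =>
    obtain ⟨k, conf, ψ, h0, hk, hψ, hall⟩ := ih
    refine ⟨k + 1, Function.update conf (k + 1) (q (t + 1), y'), Function.update ψ (k + 1) (t + 1),
      ?_, by simp, by simp, fun i hi => ?_⟩
    · rw [Function.update_of_ne (by omega), h0]
    · rw [Function.update_of_ne (show i ≠ k + 1 by omega),
        Function.update_of_ne (show i ≠ k + 1 by omega)]
      rcases Nat.eq_or_lt_of_le (Nat.lt_succ_iff.1 hi) with rfl | hi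
      · rw [Function.update_self, Function.update_self, hψ, hk]
        exact ⟨⟨hrules t ht, he⟩, ht, by omega, hg⟩
      · rw [Function.update_of_ne (show i + 1 ≠ k + 1 by omega),
          Function.update_of_ne (show i + 1 ≠ k + 1 by omega)]
        exact hall i hi
  | @cut s t y hst hq _ ih =>
    obtain ⟨k, conf, ψ, h0, hk, hψ, hall⟩ := ih
    -- A cut leaves the run as it is and only moves the position of its last configuration to the
    -- end of the cycle, from where the next operation is taken.
    refine ⟨k, conf, Function.update ψ k t, h0, by rw [hk, hq], by simp, fun i hi => ?_⟩
    have h1 := hall i hi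
    rw [Function.update_of_ne (show i ≠ k by omega)]
    refine ⟨h1.1, h1.2.1, ?_, h1.2.2.2⟩
    by_cases hik : i + 1 = k
    · subst hik
      rw [Function.update_self]
      omega
    · rw [Function.update_of_ne hik]
      exact h1.2.2.1

namespace Semirun

variable {C : POCA Q P} {μ ν : P → ℕ}

/-- The configuration at a position, the last one beyond the end. -/
def confAt (π : C.Semirun μ) (t : ℕ) : Q × ℤ := π.conf ⟨Min.min t π.len, by omega⟩

/-- The operation at a position, without effect beyond the end. -/
def opAt (π : C.Semirun μ) (t : ℕ) : Op P :=
  if h : t < π.len then π.op ⟨t, h⟩ else .addConst 0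

theorem confAt_of_le (π : C.Semirun μ) {t : ℕ} (h : t ≤ π.len) :
    π.confAt t = π.conf ⟨t, by omega⟩ := by
  unfold confAt
  congr 2
  omega

theorem opAt_of_lt (π : C.Semirun μ) {t : ℕ} (h : t < π.len) : π.opAt t = π.op ⟨t, h⟩ :=
  dif_pos h

theorem semiStep_confAt (π : C.Semirun μ) {t : ℕ} (h : t < π.len) :
    C.SemiStep μ (π.opAt t) (π.confAt t) (π.confAt (t + 1)) := by
  rw [π.opAt_of_lt h, π.confAt_of_le h.le, π.confAt_of_le h]
  exact π.step ⟨t, h⟩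

theorem min_le_confAt (π : C.Semirun μ) (t : ℕ) : π.min ≤ (π.confAt t).2 :=
  Finset.inf'_le _ (Finset.mem_univ _)

theorem confAt_le_max (π : C.Semirun μ) (t : ℕ) : (π.confAt t).2 ≤ π.max :=
  Finset.le_sup' π.val (Finset.mem_univ _)

/-- The counter value `y` may replace the value at position `t` of `π` in a min-rising and
max-falling `ℓ`-embedding. -/
def Replaceable (π : C.Semirun μ) (ℓ : ℤ) (t : ℕ) (y : ℤ) : Prop :=
  (π.min ≤ y ∧ y ≤ π.max) ∧ (ℓ < y ↔ ℓ < (π.confAt t).2) ∧ (ℓ = y ↔ ℓ = (π.confAt t).2) ∧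
    (ℓ > y ↔ ℓ > (π.confAt t).2)

theorem replaceable_self (π : C.Semirun μ) (ℓ : ℤ) (t : ℕ) :
    π.Replaceable ℓ t (π.confAt t).2 :=
  ⟨⟨π.min_le_confAt t, π.confAt_le_max t⟩, Iff.rfl, Iff.rfl, Iff.rfl⟩

theorem exists_embedding_of_cutReach (π : C.Semirun μ) (ℓ : ℤ)
    (h : CutReach ν π.len (fun t => (π.confAt t).1) π.opAt (π.confAt 0).2 (π.Replaceable ℓ)
      π.len (π.confAt π.len).2) :
    ∃ σ : C.Semirun ν, σ.source = π.source ∧ σ.target = π.target ∧ σ.IsEmbedding ℓ π ∧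
      σ.MinRising π ∧ σ.MaxFalling π := by
  obtain ⟨k, conf, ψ, h0, hk, hψ, hall⟩ := h.exists_run (C := C)
    (fun t ht => (π.semiStep_confAt ht).1)
  have hmono : ∀ i j, i < j → j ≤ k → ψ i < ψ j := by
    intro i j hij
    induction j, hij using Nat.le_induction with
    | base => exact fun hk => (hall i (by omega)).2.2.1
    | succ j hij ih => exact fun hk => (ih (by omega)).trans (hall j (by omega)).2.2.1
  have hle : ∀ i ≤ k, ψ i ≤ π.len := by
    intro i hi
    rcases Nat.eq_or_lt_of_le hi with rfl | hi
    · exact hψ.le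
    · exact (hall i hi).2.1.le
  have hgood : ∀ i ≤ k, π.Replaceable ℓ (ψ i) (conf i).2 := by
    intro i hi
    rcases Nat.eq_or_lt_of_le hi with rfl | hi
    · rw [hψ, hk]
      exact π.replaceable_self ℓ _
    · exact (hall i hi).2.2.2
  have hs0 : conf 0 = π.conf 0 := by rw [h0]; exact π.confAt_of_le (Nat.zero_le _)
  have hsk : conf k = π.conf (Fin.last _) := by rw [hk]; exact π.confAt_of_le le_rfl
  refine ⟨⟨k, fun i => conf i, fun i => π.opAt (ψ i), fun i => (hall i i.2).1⟩, hs0, hsk,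
    ⟨congrArg Prod.fst hs0, congrArg Prod.fst hsk,
      fun i => ⟨ψ i, Nat.lt_succ_of_le (hle i (Nat.le_of_lt_succ i.2))⟩,
      fun i j hij => hmono i j hij (Nat.le_of_lt_succ j.2),
      fun i => ⟨(hall i i.2).2.1, π.opAt_of_lt (hall i i.2).2.1⟩, fun i => ?_⟩, ?_, ?_⟩
  · have := (hgood i (Nat.le_of_lt_succ i.2)).2
    rwa [π.confAt_of_le (hle i (Nat.le_of_lt_succ i.2))] at this
  · exact Finset.le_inf' _ _ fun i _ => (hgood i (Nat.le_of_lt_succ i.2)).1.1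
  · exact Finset.sup'_le _ _ fun i _ => (hgood i (Nat.le_of_lt_succ i.2)).1.2

/-- The balance of the parameter updates before a position. -/
def balance (π : C.Semirun μ) (t : ℕ) : ℤ := ∑ s ∈ Finset.range t, (π.opAt s).paramSign

theorem balance_succ (π : C.Semirun μ) (t : ℕ) :
    π.balance (t + 1) = π.balance t + (π.opAt t).paramSign := Finset.sum_range_succ _ _

end Semirun

/-! ### Application to hills and valleys -/

/-- This makes the maximal drop `4 * Γ` fit into the distance `Υ + Γ + 1` between `B` and the
embedding level. -/
theorem three_mul_Gam_le_Ups [Fintype Q] (C : POCA Q P) : 3 * C.Gam ≤ C.Ups := by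
  have hQ : 0 < Fintype.card Q := Fintype.card_pos_iff.2 ⟨C.init⟩
  unfold Gam Ups
  set L := lcmUpTo (17 * Fintype.card Q)
  calc 3 * (L * C.Z) ≤ (17 * Fintype.card Q) * (L * C.Z) := Nat.mul_le_mul_right _ (by omega)
    _ = 17 * Fintype.card Q * L * (1 * C.Z) := by ring
    _ ≤ _ := by
      refine Nat.mul_le_mul_left _ ?_
      have : 1 * C.Z ≤ 17 * Fintype.card Q * C.Z := Nat.mul_le_mul_right _ (by omega)
      omega

theorem Gam_pos [Fintype Q] (C : POCA Q P) : 0 < C.Gam :=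
  Nat.mul_pos (lcmNonzero_pos _) (lcmNonzero_pos _)

namespace Semirun

/-- Semirun version of `band_cut`. With `ε = 1` it treats hills and with `ε = -1` valleys. -/
theorem cutReach_of_bands [Fintype Q] {C : POCA Q P}
    (hmod : ∀ (q q' : Q) (c : ℕ), (q, Op.modTest c, q') ∈ C.rules → c ≠ 0)
    {N : ℕ} (hN : C.M < N) (π : C.Semirun (fun _ => N)) (ε zs : ℤ) (hε : ε = 1 ∨ ε = -1)
    (hz : ∀ t ≤ π.len, zs ≤ ε * (π.confAt t).2 ∧ ε * (π.confAt t).2 ≤ zs + 4 * N)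
    (hz0 : ε * (π.confAt 0).2 ≤ zs + N - C.Ups)
    (hzn : ε * (π.confAt π.len).2 ≤ zs + N - C.Ups) (Good : ℕ → ℤ → Prop)
    (hgood0 : Good 0 (π.confAt 0).2)
    (hgood : ∀ t y, 0 < t → t < π.len → zs ≤ ε * y → ε * y ≤ ε * (π.confAt t).2 →
      ε * (π.confAt t).2 ≤ ε * y + 4 * C.Gam → Good t y) :
    CutReach (fun _ => N - C.Gam) π.len (fun t => (π.confAt t).1) π.opAt (π.confAt 0).2 Good
      π.len (π.confAt π.len).2 := by
  have : Nonempty Q := ⟨C.init⟩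
  have hεε : ε * ε = 1 := by rcases hε with rfl | rfl <;> norm_num
  have hM : (30 : ℤ) * (C.Ups + C.Gam + 1) < N := by
    unfold M at hN
    exact_mod_cast hN
  have hGN : C.Gam ≤ N := by omega
  have hZG : (C.Z : ℤ) ∣ C.Gam := Int.natCast_dvd_natCast.2 (dvd_mul_left _ _)
  have main := band_cut (n := π.len) (fun t => (π.confAt t).1)
    (fun t => ε * ((π.confAt t).2 - N * π.balance t)) (fun t => ε * π.balance t) N
    (lcmUpTo (17 * Fintype.card Q)) C.Z zs C.Gam C.Ups (lcmNonzero_pos _) (lcmNonzero_pos _)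
    (fun d h1 h2 => dvd_lcmNonzero (Finset.mem_Icc.2 ⟨h1, h2⟩) (by omega))
    (by rw [Gam]; push_cast; rfl) rfl hM ?_ ?_ (by simp [balance])
    (by simpa [balance] using hz0) (by linarith)
    (fun t c => CutReach (fun _ => N - C.Gam) π.len (fun t => (π.confAt t).1) π.opAt
      (π.confAt 0).2 Good t ((π.confAt t).2 + ε * c - π.balance t * C.Gam))
    (by simpa [balance] using CutReach.init) ?_ ?_
  · convert main using 1
    linear_combination (-π.balance π.len * C.Gam) * hεε
  · intro t ht
    have h1 := (π.semiStep_confAt ht).2.walk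
    simp only [balance_succ]
    rcases hε with rfl | rfl <;> constructor <;> linarith
  · intro t ht
    have := hz t ht
    constructor <;> linarith
  · intro t ht c hZc hb hR
    refine CutReach.step ht hR ?_ ?_
    · rcases Nat.eq_zero_or_pos t with rfl | h0
      · rwa [hR.eq_of_zero]
      · obtain ⟨b1, b2, b3⟩ := hb h0
        have e1 : ε * ((π.confAt t).2 + ε * c - π.balance t * C.Gam) =
            ε * (π.confAt t).2 + c - ε * π.balance t * C.Gam := by
          linear_combination c * hεε
        refine hgood t _ h0 ht ?_ ?_ ?_ <;> rw [e1] <;> linarith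
    · have hstep := π.semiStep_confAt ht
      -- The shift is a combination of `c` and `Γ`, both multiples of `Z` and hence of every modulus
      -- tested.
      have := hstep.2.shift hGN (x := ε * c - π.balance t * C.Gam) (fun d hd => by
        have hr := hstep.1
        rw [hd] at hr
        have hdZ : (d : ℤ) ∣ C.Z := Int.natCast_dvd_natCast.2 (dvd_lcmNonzero
          (Finset.mem_biUnion.2 ⟨_, hr, Finset.mem_singleton_self _⟩) (hmod _ _ _ hr))
        exact dvd_sub ((hdZ.trans hZc).mul_left _) ((hdZ.trans hZG).mul_left _))
      convert this using 1
      · ring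
      · rw [balance_succ]; ring
  · intro s t _ hst _ hq hb c hR
    have hb' : π.balance s = π.balance t := by
      linear_combination ε * hb - (π.balance s - π.balance t) * hεε
    convert CutReach.cut (t := t) hst hq hR using 1
    rw [hb']
    linear_combination ((π.confAt s).2 - (π.confAt t).2) * hεε

end Semirun

end POCA

open POCA Semirun in
theorem mainTheorem5 {Q P : Type*} [Fintype Q] [Unique P] (C : POCA Q P)
    (hmod : ∀ (q q' : Q) (c : ℕ), (q, Op.modTest c, q') ∈ C.rules → c ≠ 0)
    (N B : ℕ) (hN : N > C.M) (π : C.NSemirun N)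
    (hπ : π.values ⊆ Set.Icc 0 (4 * (N : ℤ))) :
    (π.IsHill (B : ℤ) →
      ∃ σ : C.NSemirun (N - C.Gam),
        σ.source = π.source ∧ σ.target = π.target ∧
        σ.IsEmbedding ((B : ℤ) - C.Ups - C.Gam - 1) π ∧
        σ.MinRising π ∧ σ.MaxFalling π) ∧
    (π.IsValley (B : ℤ) →
      ∃ σ : C.NSemirun (N - C.Gam),
        σ.source = π.source ∧ σ.target = π.target ∧
        σ.IsEmbedding ((B : ℤ) + C.Ups + C.Gam + 1) π ∧
        σ.MinRising π ∧ σ.MaxFalling π) := by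
  have hM : 30 * (C.Ups + C.Gam + 1) < N := hN
  have hUG := C.three_mul_Gam_le_Ups
  have hG := C.Gam_pos
  have hval : ∀ t, 0 ≤ (π.confAt t).2 ∧ (π.confAt t).2 ≤ 4 * (N : ℤ) :=
    fun t => hπ ⟨⟨Min.min t π.len, by omega⟩, rfl⟩
  have e0 : π.val 0 = (π.confAt 0).2 := by rw [π.confAt_of_le (Nat.zero_le _)]; rfl
  have en : π.val (Fin.last _) = (π.confAt π.len).2 := by rw [π.confAt_of_le le_rfl]; rfl
  have eop : ∀ t (ht : t < π.len), π.op ⟨t, ht⟩ = π.opAt t := fun t ht => (π.opAt_of_lt ht).symm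
  have ecs : ∀ t (ht : t < π.len), π.val (Fin.castSucc ⟨t, ht⟩) = (π.confAt t).2 := fun t ht => by
    rw [π.confAt_of_le ht.le]; rfl
  have esu : ∀ t (ht : t < π.len), π.val (Fin.succ ⟨t, ht⟩) = (π.confAt (t + 1)).2 :=
    fun t ht => by rw [π.confAt_of_le ht]; rfl
  constructor
  · rintro ⟨h0, hn, hin, hsub, hadd⟩
    rw [e0] at h0 hsub
    rw [en] at hn hadd
    have hin' : ∀ t, 0 < t → t < π.len → (B : ℤ) ≤ (π.confAt t).2 := fun t h1 h2 => by
      rw [← ecs t h2]; exact hin _ h1 h2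
    obtain ⟨c1, c2⟩ := hill_ends_close (n := π.len) (z := fun t => (π.confAt t).2)
      (s := fun t => (π.opAt t).paramSign) (N := N) (U := C.Ups) (B := B) (by omega) (by omega)
      (fun t => Op.paramSign_cases _) (fun t ht => (π.semiStep_confAt ht).2.walk) h0 hn hin'
      (fun t ht hs => by
        obtain ⟨p, hp⟩ := Op.subParam_of_paramSign hs
        have := hsub ⟨t, ht⟩ p ((eop t ht).trans hp)
        rwa [ecs] at this)
      (fun t ht hs => by
        obtain ⟨p, hp⟩ := Op.addParam_of_paramSign hs
        have := hadd ⟨t, ht⟩ p ((eop t ht).trans hp)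
        rwa [esu] at this)
    refine π.exists_embedding_of_cutReach _ (cutReach_of_bands hmod hN π 1
      (Min.min (π.confAt 0).2 (π.confAt π.len).2) (Or.inl rfl) (fun t ht => ?_) (by omega)
      (by omega) _ (π.replaceable_self _ 0) (fun t y h1 h2 h3 h4 h5 => ?_))
    · have := hval t
      have v0 := hval 0
      have vn := hval π.len
      rcases Nat.eq_zero_or_pos t with rfl | h1
      · omega
      · rcases Nat.eq_or_lt_of_le ht with rfl | h2
        · omega
        · have := hin' t h1 h2
          omega
    · have := hin' t h1 h2
      have m0 := π.min_le_confAt 0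
      have mn := π.min_le_confAt π.len
      have mt := π.confAt_le_max t
      -- Both the old value, at least `B`, and the new one, at least `B - 4 * Γ`, lie strictly above
      -- the level `B - Υ - Γ - 1`.
      refine ⟨⟨by omega, by omega⟩, by omega, by omega, by omega⟩
  · rintro ⟨h0, hn, hin, hsub, hadd⟩
    rw [e0] at h0 hadd
    rw [en] at hn hsub
    have hin' : ∀ t, 0 < t → t < π.len → (π.confAt t).2 ≤ (B : ℤ) := fun t h1 h2 => by
      rw [← ecs t h2]; exact hin _ h1 h2
    -- Negating the counter exchanges `+p` and `-p` and turns the valley into a hill at level `-B`.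
    obtain ⟨c1, c2⟩ := hill_ends_close (n := π.len) (z := fun t => -(π.confAt t).2)
      (s := fun t => -(π.opAt t).paramSign) (N := N) (U := C.Ups) (B := -B) (by omega) (by omega)
      (fun t => by have := Op.paramSign_cases (π.opAt t); omega)
      (fun t ht => by
        have := (π.semiStep_confAt ht).2.walk
        constructor <;> linarith)
      (by omega) (by omega) (fun t h1 h2 => by have := hin' t h1 h2; omega)
      (fun t ht hs => by
        obtain ⟨p, hp⟩ := Op.addParam_of_paramSign (neg_inj.1 hs)
        have := hadd ⟨t, ht⟩ p ((eop t ht).trans hp)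
        rw [ecs] at this
        linarith)
      (fun t ht hs => by
        obtain ⟨p, hp⟩ := Op.subParam_of_paramSign (o := π.opAt t) (by linarith)
        have := hsub ⟨t, ht⟩ p ((eop t ht).trans hp)
        rw [esu] at this
        linarith)
    refine π.exists_embedding_of_cutReach _ (cutReach_of_bands hmod hN π (-1)
      (Min.min (-(π.confAt 0).2) (-(π.confAt π.len).2)) (Or.inr rfl) (fun t ht => ?_) (by omega)
      (by omega) _ (π.replaceable_self _ 0) (fun t y h1 h2 h3 h4 h5 => ?_))
    · have := hval t
      have v0 := hval 0
      have vn := hval π.len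
      rcases Nat.eq_zero_or_pos t with rfl | h1
      · omega
      · rcases Nat.eq_or_lt_of_le ht with rfl | h2
        · omega
        · have := hin' t h1 h2
          omega
    · have := hin' t h1 h2
      have m0 := π.confAt_le_max 0
      have mn := π.confAt_le_max π.len
      have mt := π.min_le_confAt t
      refine ⟨⟨by omega, by omega⟩, by omega, by omega, by omega⟩
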